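/- Let $I=[-1,1]$. A real-valued logarithmic derivative of degree $m\ge 0$ is a function $\rho(x)=\sum_{k=1}^{m}\frac{1}{x-z_k}$ of a real variable $x$, where the poles $z_1,\dots,z_m\in\mathbb C$, counted with multiplicity, form a collection symmetric with respect to the real line (for $m=0$, $\rho\equiv 0$). Write $\|g\|=\sup_{x\in I}|g(x)|$, with $\|f-\rho\|=\infty$ if $\rho$ has a pole on $I$. Let $n\ge 0$, let $\rho_n$ be a real-valued logarithmic derivative of degree $n$ whose poles $z_1,\dots,z_n$ are pairwise distinct and satisfy $|z_k|>1$, and let $f:I\to\mathbb R$ be continuous. Then the following are equivalent: (i) $\rho_n$ is the unique best uniform approximant of $f$ on $I$ among the real-valued logarithmic derivatives of degree at most $n$, i.e. $\|f-\rho_n\|\le\|f-\rho\|$ for every such $\rho$, and equality holds only for $\rho=\rho_n$; (ii) $f-\rho_n$ has a Chebyshev alternance of $n+1$ points on $I$, i.e. there are points $-1\le t_1<t_2<\dots<t_{n+1}\le 1$ and a sign $\varepsilon\in\{1,-1\}$ with $f(t_k)-\rho_n(t_k)=\varepsilon(-1)^k\|f-\rho_n\|$ for $k=1,\dots,n+1$.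 The same equivalence holds if in (i) the competitors $\rho$ are restricted to the real-valued logarithmic derivatives of degree exactly $n$. -/

import Mathlib

open Set

noncomputable section

namespace LogDer

/-- The segment `I = [-1, 1]`. -/
def seg : Set ℝ := Icc (-1) 1

/-- The logarithmic derivative `ρ(x) = ∑ 1 / (x - z_k)` at a real point `x`. The poles `z_k` are
given, with multiplicity, by the finite multiset `s`; its cardinality is the degree, and the empty
multiset gives `ρ₀ = 0`. -/
def ld (s : Multiset ℂ) (x : ℝ) : ℂ := (s.map fun z => 1 / ((x : ℂ) - z)).sum

/-- The multiset of poles is symmetric with respect to the real line (multiplicities included):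
the logarithmic derivative is real-valued on the real line. -/
def RealValued (s : Multiset ℂ) : Prop := s.map (starRingEnd ℂ) = s

/-- No pole lies on `I`, i.e. the logarithmic derivative is finite on `I`. (One with a
pole on `I` is unbounded on `I`, so it has infinite deviation from every continuous function.) -/
def FiniteOnSeg (s : Multiset ℂ) : Prop := ∀ x ∈ seg, (x : ℂ) ∉ s

/-- The uniform norm on `I`. -/
def supNorm (g : ℝ → ℂ) : ℝ := ⨆ x : seg, ‖g x‖

/-- The difference `f - ρ`. -/
def diff (f : ℝ → ℝ) (s : Multiset ℂ) (x : ℝ) : ℂ := (f x : ℂ) - ld s x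

/-- Real-valued logarithmic derivatives of degree at most `n` (finite on `I`). -/
def degreeLE (n : ℕ) : Set (Multiset ℂ) :=
  {s | s.card ≤ n ∧ RealValued s ∧ FiniteOnSeg s}

/-- Real-valued logarithmic derivatives of degree exactly `n` (finite on `I`). -/
def degreeEQ (n : ℕ) : Set (Multiset ℂ) :=
  {s | s.card = n ∧ RealValued s ∧ FiniteOnSeg s}

/-- `s` is a best uniform approximant of `f` on `I` in the class `C`. -/
def IsBest (C : Set (Multiset ℂ)) (f : ℝ → ℝ) (s : Multiset ℂ) : Prop :=
  s ∈ C ∧ ∀ s' ∈ C, supNorm (diff f s) ≤ supNorm (diff f s')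

/-- `s` is the unique best uniform approximant of `f` on `I` in the class `C`. -/
def IsUniqueBest (C : Set (Multiset ℂ)) (f : ℝ → ℝ) (s : Multiset ℂ) : Prop :=
  IsBest C f s ∧ ∀ s', IsBest C f s' → s' = s

/-- `g` has a Chebyshev alternance of `m` points on `I`: there are points `t_1 < ⋯ < t_m` of `I`
at which `g` takes the values `± ‖g‖` with alternating signs. -/
def HasAlternance (m : ℕ) (g : ℝ → ℂ) : Prop :=
  ∃ t : Fin m → ℝ, StrictMono t ∧ (∀ k, t k ∈ seg) ∧
    ∃ ε : ℝ, (ε = 1 ∨ ε = -1) ∧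
      ∀ k, g (t k) = ((ε * (-1) ^ (k : ℕ) * supNorm g : ℝ) : ℂ)

end LogDer

end

/-! Let P be the monic real polynomial with zeros `s`, so that ρ = P'/P. For two such polynomials
the residuals satisfy (f - P'/P) - (f - Q'/Q) = W(P,Q)/(PQ), where W is the Wronskian. On I the
product PQ has constant sign, so comparing ρ with a competitor is a question about W(P,Q), which is
linear in Q.

Since P has simple zeros, W(P,U)/P² with deg U ≤ n is a combination of the functions 1/(x - z)². The
heart of the proof is that the W(P,U) behave as a Chebyshev system on I: on n + 1 nodes they are
annihilated by a functional with coefficients of alternating sign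
(`exists_alternating_annihilator`). As in Borchardt's identity, these coefficients are permanents of
Cauchy matrices times explicit products (`annihPoles`). The condition |z| > 1 makes the symmetrised
product of two conjugate columns positive, so the permanent has constant phase
(`exists_cauchyPerm_pos`).

If there is an alternance and the competitor is at least as good, then W(P,Q) weakly alternates at
the nodes. The functional forces it to vanish there, hence identically, and Q = P
(`eq_of_hasAlternance`).

If ρ is best, no W(P,U) has the sign of the residual at all extremal points, since otherwise P + δU
improves on P. By separation and Carathéodory, a functional on at most n + 1 extremal points
annihilates all W(P,U). It is proportional to the alternating one, so its support has exactly n + 1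
points and the residual alternates on it (`hasAlternance_of_best`). -/

noncomputable section

namespace LogDer

open Polynomial Finset

/-! ### Cauchy permanents and Borchardt's identity. -/

section Algebra

variable {K : Type*} [Field K]

/-- The monic polynomial with the given list of roots, as a function. -/
def listNodal (l : List K) (y : K) : K := (l.map fun z => y - z).prod

theorem listNodal_cons (z : K) (l : List K) (y : K) :
    listNodal (z :: l) y = (y - z) * listNodal l y := by
  simp [listNodal]

/-- `listNodal` as a polynomial. -/
def listNodalPoly (l : List K) : K[X] := (l.map fun z => X - C z).prod

theorem eval_listNodalPoly (l : List K) (y : K) : (listNodalPoly l).eval y = listNodal l y := by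
  induction l with
  | nil => simp [listNodalPoly, listNodal]
  | cons z l ih =>
    rw [listNodal_cons, ← ih]
    simp [listNodalPoly]

theorem natDegree_listNodalPoly (l : List K) : (listNodalPoly l).natDegree = l.length := by
  rw [listNodalPoly, ← Multiset.prod_coe, ← Multiset.map_coe,
    Polynomial.natDegree_multiset_prod_X_sub_C_eq_card]
  simp

variable [DecidableEq K]

/-- The permanent of the Cauchy matrix `(1 / (t - z))`, with rows indexed by `T` and columns by
`l`, expanded along its columns. -/
def cauchyPerm : List K → Finset K → K
  | [], _ => 1
  | z :: l, T => ∑ t ∈ T, (t - z)⁻¹ * cauchyPerm l (T.erase t)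

theorem cauchyPerm_cons (z : K) (l : List K) (T : Finset K) :
    cauchyPerm (z :: l) T = ∑ t ∈ T, (t - z)⁻¹ * cauchyPerm l (T.erase t) := rfl

/-- Sums over ordered pairs of distinct elements may be taken in either order. -/
theorem sum_sum_erase_comm {ι M : Type*} [DecidableEq ι] [AddCommMonoid M] (T : Finset ι)
    (g : ι → ι → M) :
    ∑ t ∈ T, ∑ u ∈ T.erase t, g t u = ∑ t ∈ T, ∑ u ∈ T.erase t, g u t := by
  rw [Finset.sum_comm' (t' := T) (s' := fun u => T.erase u)]
  intro x y
  simp only [Finset.mem_erase]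
  tauto

theorem cauchyPerm_cons_cons (z w : K) (l : List K) (T : Finset K) :
    cauchyPerm (z :: w :: l) T = ∑ t ∈ T, ∑ u ∈ T.erase t,
      (t - z)⁻¹ * (u - w)⁻¹ * cauchyPerm l ((T.erase t).erase u) := by
  simp only [cauchyPerm_cons, Finset.mul_sum, mul_assoc]

theorem cauchyPerm_perm {l l' : List K} (h : l.Perm l') (T : Finset K) :
    cauchyPerm l T = cauchyPerm l' T := by
  induction h generalizing T with
  | nil => rfl
  | cons z _ ih => simp only [cauchyPerm_cons, ih]
  | swap z w l =>
    rw [cauchyPerm_cons_cons, cauchyPerm_cons_cons, sum_sum_erase_comm]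
    refine Finset.sum_congr rfl fun t _ => Finset.sum_congr rfl fun u _ => ?_
    rw [Finset.erase_right_comm, mul_comm (u - w)⁻¹]
  | trans _ _ ih₁ ih₂ => rw [ih₁, ih₂]

/-- The coefficients of the functional supported by `T` which annihilates the functions
`1 / (x - z) ^ 2`, `z ∈ l`. -/
def annih (l : List K) (T : Finset K) (t : K) : K :=
  cauchyPerm l (T.erase t) * listNodal l t / ∏ u ∈ T.erase t, (t - u)

theorem annih_perm {l l' : List K} (h : l.Perm l') (T : Finset K) (t : K) :
    annih l T t = annih l' T t := by
  simp only [annih, cauchyPerm_perm h, listNodal, (h.map _).prod_eq]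

/-- The statement that `annih` annihilates `1 / (x - z) ^ 2` for the poles `z` of the list. -/
def AnnihPoles (l : List K) : Prop :=
  ∀ T : Finset K, T.card = l.length + 1 → (∀ z ∈ l, z ∉ T) →
    ∀ z ∈ l, ∑ t ∈ T, annih l T t * ((t - z)⁻¹) ^ 2 = 0

/-- The value of the functional `annih` at `1 / (x - y) ^ 2` for arbitrary `y`. -/
def AnnihValue (l : List K) : Prop :=
  ∀ T : Finset K, T.card = l.length + 1 → (∀ z ∈ l, z ∉ T) → ∀ y ∉ T,
    ∑ t ∈ T, annih l T t * ((t - y)⁻¹) ^ 2 =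
      - (listNodal l y / (∏ u ∈ T, (y - u)) * cauchyPerm (y :: l) T)

/-- Multiplied by ∏ (y - u), the difference of the two sides is the value of a polynomial `H`: each
`N t` vanishes at t, so division by X - t is exact. Its degree is less than the length of `l`, and
it vanishes at every z of `l`, where both the functional and `listNodal` are zero. Hence `H = 0`. -/
theorem AnnihPoles.annihValue {l : List K} (hl : l.Nodup) (hA : AnnihPoles l) :
    AnnihValue l := by
  intro T hT hlT y hy
  set R : K → K[X] := fun t => ∏ u ∈ T.erase t, (X - C u) with hR
  set c : K → K := fun t => listNodal l t / ∏ u ∈ T.erase t, (t - u) with hc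
  set N : K → K[X] := fun t => C (c t) * R t - listNodalPoly l with hN
  have hprod : ∀ t ∈ T, ∏ u ∈ T.erase t, (t - u) ≠ 0 := fun t _ =>
    Finset.prod_ne_zero_iff.2 fun u hu => sub_ne_zero.2 (Finset.ne_of_mem_erase hu).symm
  have evalR : ∀ t x, (R t).eval x = ∏ u ∈ T.erase t, (x - u) := fun t x => by
    simp [hR, eval_prod]
  have hNroot : ∀ t ∈ T, (N t).eval t = 0 := fun t ht => by
    simp [hN, hc, evalR, eval_listNodalPoly, hprod t ht]
  have hNdeg : ∀ t ∈ T, (N t).degree ≤ (l.length : ℕ) := fun t ht => by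
    refine (degree_sub_le _ _).trans (max_le ?_ ?_)
    · rw [← smul_eq_C_mul]
      refine (degree_smul_le _ _).trans ?_
      have : (R t).natDegree = l.length := by
        simp only [hR]
        rw [natDegree_prod_of_monic _ _ fun u _ => monic_X_sub_C u]
        simp [Finset.card_erase_of_mem ht, hT]
      exact degree_le_of_natDegree_le this.le
    · exact degree_le_of_natDegree_le (natDegree_listNodalPoly l).le
  set q : K → K[X] := fun t => N t /ₘ (X - C t) with hq
  have hqmul : ∀ t ∈ T, (X - C t) * q t = N t := fun t ht =>
    mul_divByMonic_eq_iff_isRoot.2 (hNroot t ht)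
  have hqdeg : ∀ t ∈ T, (q t).degree < (l.length : ℕ) := fun t ht => by
    by_cases h0 : N t = 0
    · simp only [hq, h0, zero_divByMonic, degree_zero]
      exact WithBot.bot_lt_coe _
    · exact (degree_divByMonic_lt _ (X - C t) h0 (by simp)).trans_le (hNdeg t ht)
  have hqeval : ∀ t ∈ T, ∀ x, x ∉ T → (q t).eval x =
      (x - t)⁻¹ * (c t * ∏ u ∈ T.erase t, (x - u) - listNodal l x) := fun t ht x hx => by
    have h := congrArg (eval x) (hqmul t ht)
    have hxt : x - t ≠ 0 := sub_ne_zero.2 fun h => hx (h ▸ ht)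
    simp only [eval_mul, eval_sub, eval_X, eval_C, hN, evalR, eval_listNodalPoly] at h
    rw [← h, inv_mul_cancel_left₀ hxt]
  set H : K[X] := ∑ t ∈ T, C (cauchyPerm l (T.erase t)) * q t with hH
  have hHeval : ∀ x, x ∉ T → H.eval x = (∏ u ∈ T, (x - u)) *
      (∑ t ∈ T, annih l T t * ((t - x)⁻¹) ^ 2) + listNodal l x * cauchyPerm (x :: l) T := by
    intro x hx
    rw [hH, eval_finsetSum, cauchyPerm_cons, Finset.mul_sum, Finset.mul_sum,
      ← Finset.sum_add_distrib]
    refine Finset.sum_congr rfl fun t ht => ?_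
    have hxt : x - t ≠ 0 := sub_ne_zero.2 fun h => hx (h ▸ ht)
    have htx : (t - x)⁻¹ = - (x - t)⁻¹ := by rw [← neg_sub, inv_neg]
    rw [eval_mul, eval_C, hqeval t ht x hx, ← Finset.mul_prod_erase T _ ht, annih, htx]
    simp only [hc]
    field_simp
    ring
  have hH0 : H = 0 := by
    refine eq_zero_of_degree_lt_of_eval_finset_eq_zero (s := l.toFinset) ?_ ?_
    · rw [List.toFinset_card_of_nodup hl]
      refine (degree_sum_le _ _).trans_lt ?_
      rw [Finset.sup_lt_iff (WithBot.bot_lt_coe _)]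
      intro t ht
      rw [← smul_eq_C_mul]
      exact (degree_smul_le _ _).trans_lt (hqdeg t ht)
    · intro z hz
      rw [List.mem_toFinset] at hz
      rw [hHeval z (hlT z hz), hA T hT hlT z hz]
      have : listNodal l z = 0 := List.prod_eq_zero (List.mem_map.2 ⟨z, hz, sub_self z⟩)
      simp [this]
  have h := hHeval y hy
  rw [hH0, eval_zero] at h
  have hRy : ∏ u ∈ T, (y - u) ≠ 0 :=
    Finset.prod_ne_zero_iff.2 fun u hu => sub_ne_zero.2 fun h => hy (h ▸ hu)
  refine mul_left_cancel₀ hRy ?_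
  rw [eq_neg_of_add_eq_zero_left h.symm]
  field_simp

/-- Expand the permanent along the column of z and split (t - z)⁻¹(u - z)⁻¹ into partial fractions.
After exchanging t and u in one half, the coefficient of (t - z)⁻¹ is the identity `hB` for the
nodes `T.erase t` at the point y = t, so it is zero. -/
theorem AnnihValue.sum_cons_eq_zero {z : K} {l : List K} (hB : AnnihValue l) (T : Finset K)
    (hT : T.card = l.length + 2) (hlT : ∀ w ∈ l, w ∉ T) (hz : z ∉ T) :
    ∑ t ∈ T, annih (z :: l) T t * ((t - z)⁻¹) ^ 2 = 0 := by
  set D : K → K := fun t => ∏ u ∈ T.erase t, (t - u) with hD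
  set g : K → K → K := fun t u =>
    cauchyPerm l ((T.erase t).erase u) * listNodal l t / D t * (u - t)⁻¹ with hg
  have hz' : ∀ t ∈ T, t - z ≠ 0 := fun t ht => sub_ne_zero.2 fun h => hz (h ▸ ht)
  have hterm : ∀ t ∈ T, annih (z :: l) T t * ((t - z)⁻¹) ^ 2 =
      ∑ u ∈ T.erase t, (g t u * (t - z)⁻¹ - g t u * (u - z)⁻¹) := by
    intro t ht
    rw [annih, cauchyPerm_cons, listNodal_cons, Finset.sum_mul, Finset.sum_div, Finset.sum_mul]
    refine Finset.sum_congr rfl fun u hu => ?_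
    have h1 := hz' t ht
    have h2 := hz' u (Finset.mem_of_mem_erase hu)
    have h3 : u - t ≠ 0 := sub_ne_zero.2 (Finset.ne_of_mem_erase hu)
    have h4 : D t ≠ 0 := Finset.prod_ne_zero_iff.2 fun u hu =>
      sub_ne_zero.2 (Finset.ne_of_mem_erase hu).symm
    simp only [hg]
    change _ / D t * _ = _
    field_simp
    ring
  rw [Finset.sum_congr rfl hterm]
  simp only [Finset.sum_sub_distrib]
  rw [sum_sum_erase_comm T fun t u => g t u * (u - z)⁻¹, ← Finset.sum_sub_distrib]
  refine Finset.sum_eq_zero fun t ht => ?_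
  rw [← Finset.sum_sub_distrib]
  simp only [← sub_mul]
  rw [← Finset.sum_mul]
  refine mul_eq_zero_of_left ?_ _
  have hb := hB (T.erase t) (by rw [Finset.card_erase_of_mem ht, hT]; omega)
    (fun w hw h => hlT w hw (Finset.mem_of_mem_erase h)) t (Finset.notMem_erase t T)
  rw [eq_neg_iff_add_eq_zero, cauchyPerm_cons, Finset.mul_sum, ← Finset.sum_add_distrib] at hb
  rw [← hb]
  refine Finset.sum_congr rfl fun u hu => ?_
  have h3 : u - t ≠ 0 := sub_ne_zero.2 (Finset.ne_of_mem_erase hu)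
  have hDu : D u = (u - t) * ∏ v ∈ (T.erase t).erase u, (u - v) := by
    rw [Finset.erase_right_comm, Finset.mul_prod_erase _ _
      (Finset.mem_erase.2 ⟨(Finset.ne_of_mem_erase hu).symm, ht⟩)]
  have h5 : (t - u)⁻¹ = - (u - t)⁻¹ := by rw [← neg_sub, inv_neg]
  have h6 : ∏ v ∈ (T.erase t).erase u, (u - v) ≠ 0 :=
    Finset.prod_ne_zero_iff.2 fun u hu => sub_ne_zero.2 (Finset.ne_of_mem_erase hu).symm
  have h7 : ∏ v ∈ T.erase t, (t - v) ≠ 0 :=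
    Finset.prod_ne_zero_iff.2 fun u hu => sub_ne_zero.2 (Finset.ne_of_mem_erase hu).symm
  simp only [hg, annih]
  rw [Finset.erase_right_comm (a := u), hDu, h5]
  simp only [hD]
  field_simp
  ring

/-- The functional with coefficients `annih l T` annihilates `1 / (x - z) ^ 2` for every `z` in
the list `l` (a form of Borchardt's identity). -/
theorem annihPoles (l : List K) (hl : l.Nodup) : AnnihPoles l := by
  induction hm : l.length generalizing l with
  | zero =>
    intro T _ _ z hz
    simp [List.length_eq_zero_iff.1 hm] at hz
  | succ m ih =>
    intro T hT hlT z hz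
    have hperm := List.perm_cons_erase hz
    have hnd := hl.erase z
    have hlen : (l.erase z).length = m := by rw [List.length_erase_of_mem hz, hm]; rfl
    simp only [annih_perm hperm]
    exact ((ih _ hnd hlen).annihValue hnd).sum_cons_eq_zero T (by omega)
      (fun w hw => hlT w (List.mem_of_mem_erase hw)) (hlT z hz)

end Algebra

/-! ### Wronskians as combinations of double poles. -/

/-- The Wronskian of a polynomial with simple zeros `z ∈ S` and a polynomial of at most the same
degree is, up to a square, a combination of the functions `1 / (x - z) ^ 2`. -/
theorem exists_eval_wronskian_nodal {K : Type*} [Field K] [DecidableEq K] (S : Finset K) (U : K[X])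
    (hU : U.natDegree ≤ S.card) :
    ∃ a : K → K, ∀ y ∉ S, (wronskian (Lagrange.nodal S id) U).eval y =
      (∑ z ∈ S, a z * ((y - z)⁻¹) ^ 2) * (Lagrange.nodal S id).eval y ^ 2 := by
  set N := Lagrange.nodal S id with hN
  set c := U.coeff S.card with hc
  have hinj : Set.InjOn (id : K → K) S := Function.injective_id.injOn
  have hNdeg : N.natDegree = S.card := Lagrange.natDegree_nodal
  have hdeg : (U - C c * N).degree < S.card := by
    rw [degree_lt_iff_coeff_zero]
    intro m hm
    rcases hm.eq_or_lt with rfl | hm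
    · have : N.coeff S.card = 1 := by
        rw [← hNdeg]; exact Lagrange.nodal_monic
      simp [this, hc]
    · rw [coeff_sub, coeff_C_mul, coeff_eq_zero_of_natDegree_lt (hU.trans_lt hm),
        coeff_eq_zero_of_natDegree_lt (hNdeg.trans_lt hm)]
      simp
  have hint := Lagrange.eq_interpolate hinj hdeg
  set r : K → K := fun z => (U - C c * N).eval z with hr
  set w : K → K := fun z => Lagrange.nodalWeight S id z
  have hdec : U = C c * N + ∑ z ∈ S, C (w z * r z) * Lagrange.nodal (S.erase z) id := by
    rw [← sub_eq_iff_eq_add', hint, Lagrange.interpolate_eq_nodalWeight_mul_nodal_div_X_sub_C]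
    refine Finset.sum_congr rfl fun z hz => ?_
    rw [Lagrange.nodal_erase_eq_nodal_div hz]
    simp only [C_mul, id, hr, w]
    ring
  refine ⟨fun z => - (w z * r z), fun y hy => ?_⟩
  -- The multiple of N is killed by the Wronskian, and N = (X - z)M gives W(N, M) = -M².
  have hW : wronskian N U = ∑ z ∈ S, C (- (w z * r z)) * Lagrange.nodal (S.erase z) id ^ 2 := by
    rw [← wronskianBilin_apply, hdec, map_add, map_sum]
    have h0 : wronskianBilin K N (C c * N) = 0 := by
      rw [← smul_eq_C_mul, map_smul, wronskianBilin_apply, wronskian_self_eq_zero, smul_zero]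
    rw [h0, zero_add]
    refine Finset.sum_congr rfl fun z hz => ?_
    rw [wronskianBilin_apply, wronskian, hN, Lagrange.nodal_eq_mul_nodal_erase hz]
    simp only [derivative_mul, derivative_C, derivative_sub, derivative_X, id, C_neg]
    ring
  rw [hW, eval_finsetSum, Finset.sum_mul]
  refine Finset.sum_congr rfl fun z hz => ?_
  have hyz : y - z ≠ 0 := sub_ne_zero.2 fun h => hy (h ▸ hz)
  rw [hN, Lagrange.nodal_eq_mul_nodal_erase hz]
  simp only [eval_mul, eval_C, eval_pow, eval_sub, eval_X, id]
  field_simp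

/-! ### Constant sign of the Cauchy permanent. -/

section Positivity

open ComplexOrder

/-- Inversion preserves the sign of the real part, so it suffices to treat xy - (x + y) Re z + |z|².
This is affine in x and in y; its values at the corners of the square are |1 - z|², |1 + z|² and
|z|² - 1 (twice), all positive. -/
theorem re_pair_pos {x y : ℝ} (hx : x ∈ seg) (hy : y ∈ seg) {z : ℂ} (hz : 1 < ‖z‖) :
    0 < (((x : ℂ) - z)⁻¹ * ((y : ℂ) - starRingEnd ℂ z)⁻¹).re := by
  have hq : 0 < (((x : ℂ) - z) * ((y : ℂ) - starRingEnd ℂ z)).re := by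
    have hN : 1 < z.re ^ 2 + z.im ^ 2 := by
      have h1 : (1 : ℝ) < ‖z‖ ^ 2 := by nlinarith
      rw [← Complex.normSq_eq_norm_sq, Complex.normSq_apply] at h1
      nlinarith
    have hre : (((x : ℂ) - z) * ((y : ℂ) - starRingEnd ℂ z)).re =
        x * y - z.re * (x + y) + (z.re ^ 2 + z.im ^ 2) := by
      simp
      ring
    rw [hre]
    generalize z.re = a at hN
    generalize z.im = b at hN
    obtain ⟨hx1, hx2⟩ := hx
    obtain ⟨hy1, hy2⟩ := hy
    have hA : 0 < (1 - a) ^ 2 + b ^ 2 := by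
      by_contra! h
      nlinarith [sq_nonneg (1 - a), sq_nonneg b]
    have hB : 0 < (1 + a) ^ 2 + b ^ 2 := by
      by_contra! h
      nlinarith [sq_nonneg (1 + a), sq_nonneg b]
    obtain ⟨m, hm, hmA, hmB, hmC⟩ : ∃ m > 0, m ≤ (1 - a) ^ 2 + b ^ 2 ∧ m ≤ (1 + a) ^ 2 + b ^ 2 ∧
        m ≤ a ^ 2 + b ^ 2 - 1 :=
      ⟨min (min ((1 - a) ^ 2 + b ^ 2) ((1 + a) ^ 2 + b ^ 2)) (a ^ 2 + b ^ 2 - 1),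
        lt_min (lt_min hA hB) (by linarith), (min_le_left _ _).trans (min_le_left _ _),
        (min_le_left _ _).trans (min_le_right _ _), min_le_right _ _⟩
    have p1 : 0 ≤ 1 + x := by linarith
    have p2 : 0 ≤ 1 - x := by linarith
    have q1 : 0 ≤ 1 + y := by linarith
    have q2 : 0 ≤ 1 - y := by linarith
    have e1 := mul_nonneg (mul_nonneg p1 q1) (sub_nonneg.2 hmA)
    have e2 := mul_nonneg (mul_nonneg p2 q2) (sub_nonneg.2 hmB)
    have e3 := mul_nonneg (add_nonneg (mul_nonneg p1 q2) (mul_nonneg p2 q1)) (sub_nonneg.2 hmC)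
    linarith
  rw [← mul_inv, Complex.inv_re]
  refine div_pos hq (Complex.normSq_pos.2 fun h => ?_)
  rw [h] at hq
  simp at hq

theorem pair_add_pair_pos {x y : ℝ} (hx : x ∈ seg) (hy : y ∈ seg) {z : ℂ} (hz : 1 < ‖z‖) :
    0 < ((x : ℂ) - z)⁻¹ * ((y : ℂ) - starRingEnd ℂ z)⁻¹ +
      ((y : ℂ) - z)⁻¹ * ((x : ℂ) - starRingEnd ℂ z)⁻¹ := by
  have h := re_pair_pos hx hy hz
  set w := ((x : ℂ) - z)⁻¹ * ((y : ℂ) - starRingEnd ℂ z)⁻¹ with hw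
  have : ((y : ℂ) - z)⁻¹ * ((x : ℂ) - starRingEnd ℂ z)⁻¹ = starRingEnd ℂ w := by
    rw [hw]
    simp [mul_comm]
  rw [this, Complex.add_conj]
  exact_mod_cast mul_pos two_pos h

/-- The permanent of the Cauchy matrix has a constant sign (up to a constant phase) for nodes
in `[-1, 1]` and a symmetric collection of poles outside the closed unit disc. -/
theorem exists_cauchyPerm_pos (l : List ℂ) (hreal : RealValued (l : Multiset ℂ))
    (hpoles : ∀ z ∈ l, 1 < ‖z‖) :
    ∃ ζ : ℂ, ∀ T : Finset ℂ, (∀ t ∈ T, ∃ x ∈ seg, (x : ℂ) = t) → T.card = l.length →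
      0 < ζ * cauchyPerm l T := by
  induction hm : l.length using Nat.strong_induction_on generalizing l with
  | _ m ih =>
  rcases l with _ | ⟨z, l⟩
  · exact ⟨1, fun T _ _ => by simp [cauchyPerm]⟩
  have hz : 1 < ‖z‖ := hpoles z (by simp)
  rw [List.length_cons] at hm
  rw [RealValued, ← Multiset.cons_coe, Multiset.map_cons] at hreal
  by_cases hzr : starRingEnd ℂ z = z
  · rw [hzr, Multiset.cons_inj_right] at hreal
    obtain ⟨ζ, hζ⟩ := ih l.length (by omega) l hreal
      (fun w hw => hpoles w (by simp [hw])) rfl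
    obtain ⟨a, rfl⟩ := Complex.conj_eq_iff_real.1 hzr
    have ha : 1 < a ^ 2 := by
      rw [Complex.norm_real, Real.norm_eq_abs] at hz
      rw [← sq_abs]; nlinarith
    -- The factor -a fixes the sign of the column of a real pole: -a(x - a) = a² - ax > 0 because
    -- |x| ≤ 1 < |a|.
    refine ⟨-(a : ℂ) * ζ, fun T hTseg hT => ?_⟩
    rw [cauchyPerm_cons, Finset.mul_sum]
    refine Finset.sum_pos (fun t ht => ?_) (Finset.card_pos.1 (by omega))
    have h1 := hζ (T.erase t) (fun u hu => hTseg u (Finset.mem_of_mem_erase hu))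
      (by rw [Finset.card_erase_of_mem ht]; omega)
    obtain ⟨x, hx, rfl⟩ := hTseg t ht
    have h2 : (0 : ℂ) < -(a : ℂ) * ((x : ℂ) - a)⁻¹ := by
      have : 0 < -a * (x - a)⁻¹ := by
        have hxa : 0 < -a * (x - a) := by
          have h1 := hx.1
          have h2 := hx.2
          nlinarith [sq_nonneg (x - a), sq_nonneg (x + a)]
        have hne : x - a ≠ 0 := by rintro h; simp [h] at hxa
        have : -a * (x - a)⁻¹ = (-a * (x - a)) * ((x - a)⁻¹) ^ 2 := by field_simp
        rw [this]
        positivity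
      exact_mod_cast this
    have := mul_pos h2 h1
    convert this using 1
    ring
  · have hmem : starRingEnd ℂ z ∈ l := by
      have : starRingEnd ℂ z ∈ z ::ₘ (l : Multiset ℂ) := by
        rw [← hreal]; simp
      simpa [hzr] using this
    set l' := l.erase (starRingEnd ℂ z) with hl'
    have hperm : l.Perm (starRingEnd ℂ z :: l') := List.perm_cons_erase hmem
    have hlen : l.length = l'.length + 1 := by simpa using hperm.length_eq
    have hreal' : RealValued (l' : Multiset ℂ) := by
      have h1 : (l : Multiset ℂ) = starRingEnd ℂ z ::ₘ (l' : Multiset ℂ) :=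
        Multiset.coe_eq_coe.2 hperm
      rw [h1, Multiset.map_cons, Complex.conj_conj,
        Multiset.cons_swap, Multiset.cons_inj_right, Multiset.cons_inj_right] at hreal
      exact hreal
    obtain ⟨ζ, hζ⟩ := ih l'.length (by omega) l' hreal'
      (fun w hw => hpoles w (by simp [List.mem_of_mem_erase hw])) rfl
    refine ⟨ζ, fun T hTseg hT => ?_⟩
    rw [cauchyPerm_perm (hperm.cons z), cauchyPerm_cons_cons]
    set F : ℂ → ℂ → ℂ := fun t u =>
      (t - z)⁻¹ * (u - starRingEnd ℂ z)⁻¹ * cauchyPerm l' ((T.erase t).erase u) with hF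
    -- The remaining permanent depends only on the unordered pair {t, u} removed, so symmetrisation
    -- pairs the two conjugate columns into the positive quantity of `pair_add_pair_pos`.
    have hsym : 2 * ∑ t ∈ T, ∑ u ∈ T.erase t, F t u =
        ∑ t ∈ T, ∑ u ∈ T.erase t, (F t u + F u t) := by
      simp only [Finset.sum_add_distrib]
      rw [← sum_sum_erase_comm T F, two_mul]
    have hpos : 0 < ζ * (2 * ∑ t ∈ T, ∑ u ∈ T.erase t, F t u) := by
      rw [hsym, Finset.mul_sum]
      refine Finset.sum_pos (fun t ht => ?_) (Finset.card_pos.1 (by omega))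
      rw [Finset.mul_sum]
      refine Finset.sum_pos (fun u hu => ?_)
        (Finset.card_pos.1 (by rw [Finset.card_erase_of_mem ht]; omega))
      have h1 := hζ ((T.erase t).erase u)
        (fun v hv => hTseg v (Finset.mem_of_mem_erase (Finset.mem_of_mem_erase hv)))
        (by rw [Finset.card_erase_of_mem hu, Finset.card_erase_of_mem ht]; omega)
      obtain ⟨x, hx, rfl⟩ := hTseg t ht
      obtain ⟨y, hy, rfl⟩ := hTseg u (Finset.mem_of_mem_erase hu)
      have := mul_pos (pair_add_pair_pos hx hy hz) h1
      simp only [hF]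
      rw [Finset.erase_right_comm (a := (y : ℂ))]
      convert this using 1
      ring
    have h2 : (0 : ℂ) < 2⁻¹ := by simp
    convert mul_pos h2 hpos using 1
    ring

end Positivity

/-! ### Real polynomials attached to symmetric collections of poles. -/

/-- A real polynomial without zeros on `[-1, 1]` has a constant sign there. -/
theorem exists_sign_of_ne_zero (P : ℝ[X]) (hP : ∀ x ∈ seg, P.eval x ≠ 0) :
    ∃ ε : ℝ, ∀ x ∈ seg, 0 < ε * P.eval x := by
  have h0 : (0 : ℝ) ∈ seg := by constructor <;> norm_num
  refine ⟨P.eval 0, fun x hx => ?_⟩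
  by_contra! hneg
  have hseg : IsPreconnected seg := isPreconnected_Icc
  have hcont : ContinuousOn (fun x => P.eval 0 * P.eval x) seg := by fun_prop
  obtain ⟨y, hy, hy0⟩ := hseg.intermediate_value hx h0 hcont
    ⟨hneg, mul_self_nonneg (P.eval 0)⟩
  exact (mul_ne_zero (hP 0 h0) (hP y hy)) hy0

theorem ofReal_ne_of_one_lt_norm {x : ℝ} (hx : x ∈ seg) {z : ℂ} (hz : 1 < ‖z‖) : (x : ℂ) ≠ z := by
  rintro rfl
  rw [Complex.norm_real, Real.norm_eq_abs] at hz
  exact hz.not_ge (abs_le.2 hx)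

/-- `P` is the monic real polynomial whose zeros are the poles `s`. -/
def IsPolePoly (s : Multiset ℂ) (P : ℝ[X]) : Prop :=
  P.map Complex.ofRealHom = (s.map fun z => X - C z).prod

theorem exists_isPolePoly {s : Multiset ℂ} (hs : RealValued s) : ∃ P, IsPolePoly s P := by
  have hmap : ((s.map fun z => X - C z).prod).map (starRingEnd ℂ) =
      (s.map fun z => X - C z).prod := by
    conv_rhs => rw [← hs]
    rw [Polynomial.map_multiset_prod, Multiset.map_map, Multiset.map_map]
    simp
  have hl : (s.map fun z => X - C z).prod ∈ Polynomial.lifts Complex.ofRealHom := by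
    rw [Polynomial.lifts_iff_coeff_lifts]
    intro n
    have h := congrArg (fun p => coeff p n) hmap
    simp only [coeff_map] at h
    obtain ⟨r, hr⟩ := Complex.conj_eq_iff_real.1 h
    exact ⟨r, hr.symm⟩
  exact (Polynomial.mem_lifts _).1 hl

theorem isPolePoly_roots {P : ℝ[X]} (hP : P.Monic) :
    IsPolePoly (P.map Complex.ofRealHom).roots P := by
  have h := (IsAlgClosed.splits (P.map Complex.ofRealHom)).eq_prod_roots
  rw [(hP.map Complex.ofRealHom).leadingCoeff, C_1, one_mul] at h
  exact h

theorem realValued_roots (P : ℝ[X]) : RealValued (P.map Complex.ofRealHom).roots := by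
  rw [RealValued, ← (IsAlgClosed.splits (P.map Complex.ofRealHom)).roots_map, Polynomial.map_map]
  congr 2
  ext x
  simp

theorem eval_map_ofReal (P : ℝ[X]) (x : ℝ) :
    (P.map Complex.ofRealHom).eval (x : ℂ) = ((P.eval x : ℝ) : ℂ) := by
  rw [eval_map, ← Complex.ofRealHom_eq_coe, eval₂_at_apply]; rfl

namespace IsPolePoly

variable {s : Multiset ℂ} {P : ℝ[X]}

theorem monic (h : IsPolePoly s P) : P.Monic := by
  rw [Function.Injective.monic_map_iff Complex.ofRealHom.injective, h]
  exact monic_multiset_prod_of_monic _ _ fun z _ => monic_X_sub_C z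

theorem natDegree_eq (h : IsPolePoly s P) : P.natDegree = s.card := by
  rw [← natDegree_map Complex.ofRealHom, h, natDegree_multiset_prod_X_sub_C_eq_card]

theorem roots_map (h : IsPolePoly s P) : (P.map Complex.ofRealHom).roots = s := by
  rw [h, roots_multiset_prod_X_sub_C]

theorem eval_eq_zero_iff (h : IsPolePoly s P) (z : ℂ) :
    (P.map Complex.ofRealHom).eval z = 0 ↔ z ∈ s := by
  rw [← h.roots_map, mem_roots (h.monic.map _).ne_zero, IsRoot]

theorem finiteOnSeg_iff (h : IsPolePoly s P) :
    FiniteOnSeg s ↔ ∀ x ∈ seg, P.eval x ≠ 0 := by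
  refine forall₂_congr fun x _ => not_congr ?_
  rw [← h.eval_eq_zero_iff, eval_map_ofReal, Complex.ofReal_eq_zero]

theorem ld_eq (h : IsPolePoly s P) {x : ℝ} (hx : P.eval x ≠ 0) :
    ld s x = ((P.derivative.eval x / P.eval x : ℝ) : ℂ) := by
  have h0 : (P.map Complex.ofRealHom).eval (x : ℂ) ≠ 0 := by
    rwa [eval_map_ofReal, Complex.ofReal_ne_zero]
  have := (IsAlgClosed.splits (P.map Complex.ofRealHom)).eval_derivative_div_eval_of_ne_zero h0
  rw [h.roots_map, derivative_map, eval_map_ofReal, eval_map_ofReal] at this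
  rw [ld, ← this]
  push_cast
  rfl

theorem diff_eq (h : IsPolePoly s P) (f : ℝ → ℝ) {x : ℝ} (hx : P.eval x ≠ 0) :
    diff f s x = ((f x - P.derivative.eval x / P.eval x : ℝ) : ℂ) := by
  rw [diff, h.ld_eq hx]
  push_cast
  rfl

theorem map_eq_nodal (h : IsPolePoly s P) (hs : s.Nodup) :
    P.map Complex.ofRealHom = Lagrange.nodal s.toFinset id := by
  rw [h, Lagrange.nodal_eq, Finset.prod, Multiset.toFinset_val, hs.dedup]
  rfl

theorem map_eval_eq_listNodal (h : IsPolePoly s P) (y : ℂ) :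
    (P.map Complex.ofRealHom).eval y = listNodal s.toList y := by
  rw [h, ← eval_listNodalPoly, listNodalPoly]
  congr 1
  conv_lhs => rw [← s.coe_toList]
  rw [Multiset.map_coe, Multiset.prod_coe]

end IsPolePoly

theorem map_wronskian {R S : Type*} [CommRing R] [CommRing S] (φ : R →+* S) (P U : R[X]) :
    (wronskian P U).map φ = wronskian (P.map φ) (U.map φ) := by
  simp [wronskian, derivative_map]

theorem finiteOnSeg_of_one_lt_norm {s : Multiset ℂ} (hpoles : ∀ z ∈ s, 1 < ‖z‖) :
    FiniteOnSeg s :=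
  fun _ hx hmem => ofReal_ne_of_one_lt_norm hx (hpoles _ hmem) rfl

/-! ### The alternating annihilator and the Haar property. -/

section Annihilator

open ComplexOrder

variable {s : Multiset ℂ} {P : ℝ[X]}

/-- On `n + 1` nodes of `[-1, 1]` the Wronskians `W(P, U)`, `deg U ≤ n`, are annihilated by a
functional whose coefficients alternate in sign. -/
theorem exists_alternating_annihilator (hP : IsPolePoly s P) (hreal : RealValued s)
    (hnd : s.Nodup) (hpoles : ∀ z ∈ s, 1 < ‖z‖) (T : Finset ℝ) (hTseg : ∀ t ∈ T, t ∈ seg)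
    (hT : T.card = s.card + 1) :
    ∃ a : ℝ → ℝ, (∀ t ∈ T, 0 < a t * ∏ u ∈ T.erase t, (t - u)) ∧
      ∀ U : ℝ[X], U.natDegree ≤ s.card → ∑ t ∈ T, a t * (wronskian P U).eval t = 0 := by
  have hP0 := hP.finiteOnSeg_iff.1 (finiteOnSeg_of_one_lt_norm hpoles)
  obtain ⟨ε, hε⟩ := exists_sign_of_ne_zero P hP0
  set l := s.toList with hl
  have hls : (l : Multiset ℂ) = s := s.coe_toList
  have hmem : ∀ z, z ∈ l ↔ z ∈ s := fun z => Multiset.mem_toList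
  obtain ⟨ζ, hζ⟩ := exists_cauchyPerm_pos l (by rwa [hls]) (fun z hz => hpoles z ((hmem z).1 hz))
  set e : ℝ ↪ ℂ := ⟨Complex.ofReal, Complex.ofReal_injective⟩ with he
  set T' : Finset ℂ := T.map e with hT'
  have hT'seg : ∀ t ∈ T', ∃ x ∈ seg, (x : ℂ) = t := fun t ht => by
    obtain ⟨x, hx, rfl⟩ := Finset.mem_map.1 ht
    exact ⟨x, hTseg x hx, rfl⟩
  have herase : ∀ t ∈ T, T'.erase (t : ℂ) = (T.erase t).map e := fun t _ =>
    (Finset.map_erase e T t).symm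
  have hpos : ∀ t ∈ T, 0 < ζ * cauchyPerm l (T'.erase (t : ℂ)) := fun t ht => by
    refine hζ _ (fun u hu => hT'seg u (Finset.mem_of_mem_erase hu)) ?_
    rw [herase t ht, Finset.card_map, Finset.card_erase_of_mem ht, hT, hl, Multiset.length_toList]
    rfl
  set r : ℝ → ℝ := fun t => (ζ * cauchyPerm l (T'.erase (t : ℂ))).re with hr
  have hr0 : ∀ t ∈ T, 0 < r t ∧ (r t : ℂ) = ζ * cauchyPerm l (T'.erase (t : ℂ)) := fun t ht => by
    have h := Complex.pos_iff.1 (hpos t ht)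
    exact ⟨h.1, Complex.ext rfl h.2⟩
  set D : ℝ → ℝ := fun t => ∏ u ∈ T.erase t, (t - u) with hD
  have hD0 : ∀ t, D t ≠ 0 := fun t => Finset.prod_ne_zero_iff.2 fun u hu =>
    sub_ne_zero.2 (Finset.ne_of_mem_erase hu).symm
  -- Up to the constant εζ this is `annih` divided by P(t)², which cancels the square in W(P,U). A
  -- factor P(t) stays in the denominator, and ε compensates its sign.
  refine ⟨fun t => ε * r t / (P.eval t * D t), fun t ht => ?_, fun U hU => ?_⟩
  · have h1 := hε t (hTseg t ht)
    have h2 := hP0 t (hTseg t ht)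
    have h3 : ε * r t / (P.eval t * D t) * D t = (ε * P.eval t) * r t / (P.eval t) ^ 2 := by
      have := hD0 t
      field_simp
    change 0 < ε * r t / (P.eval t * D t) * D t
    rw [h3]
    exact div_pos (mul_pos h1 (hr0 t ht).1) (by positivity)
  · obtain ⟨c, hc⟩ := exists_eval_wronskian_nodal s.toFinset (U.map Complex.ofRealHom)
      (by rw [natDegree_map, Multiset.toFinset_card_of_nodup hnd]; exact hU)
    rw [← hP.map_eq_nodal hnd, ← map_wronskian] at hc
    apply Complex.ofReal_injective
    rw [Complex.ofReal_zero, Complex.ofReal_sum]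
    have hterm : ∀ t ∈ T, ((ε * r t / (P.eval t * D t) * (wronskian P U).eval t : ℝ) : ℂ) =
        ∑ z ∈ s.toFinset, ε * ζ * c z * (annih l T' t * (((t : ℂ) - z)⁻¹) ^ 2) := by
      intro t ht
      have hts : (t : ℂ) ∉ s.toFinset := fun h =>
        finiteOnSeg_of_one_lt_norm hpoles t (hTseg t ht) (Multiset.mem_toFinset.1 h)
      have h1 := hc t hts
      rw [eval_map_ofReal, eval_map_ofReal] at h1
      have h2 : ((P.eval t : ℝ) : ℂ) ≠ 0 := Complex.ofReal_ne_zero.2 (hP0 t (hTseg t ht))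
      have h3 : (D t : ℂ) ≠ 0 := Complex.ofReal_ne_zero.2 (hD0 t)
      have h4 : annih l T' t = cauchyPerm l (T'.erase (t : ℂ)) * ((P.eval t : ℝ) : ℂ) /
            ((D t : ℝ) : ℂ) := by
        rw [annih, ← hP.map_eval_eq_listNodal, eval_map_ofReal, herase t ht, Finset.prod_map]
        simp [hD, he]
      push_cast
      rw [h1, (hr0 t ht).2, h4, Finset.sum_mul, Finset.mul_sum]
      refine Finset.sum_congr rfl fun z _ => ?_
      field_simp
    rw [Finset.sum_congr rfl hterm, Finset.sum_comm]
    refine Finset.sum_eq_zero fun z hz => ?_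
    rw [← Finset.mul_sum]
    have hz' : z ∈ l := (hmem z).2 (Multiset.mem_toFinset.1 hz)
    have hA := annihPoles l (by rwa [← Multiset.coe_nodup, hls]) T'
      (by rw [Finset.card_map, hT, hl, Multiset.length_toList])
      (fun w hw h => by
        obtain ⟨x, hx, rfl⟩ := hT'seg w h
        exact finiteOnSeg_of_one_lt_norm hpoles x hx ((hmem _).1 hw)) z hz'
    rw [Finset.sum_map] at hA
    exact mul_eq_zero_of_right _ hA

/-- Haar property: a Wronskian `W(P, U)`, `deg U ≤ n`, with `n` zeros on `[-1, 1]` vanishes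
identically. -/
theorem wronskian_eq_zero_of_zeros (hP : IsPolePoly s P) (hreal : RealValued s)
    (hnd : s.Nodup) (hpoles : ∀ z ∈ s, 1 < ‖z‖) (Z : Finset ℝ) (hZseg : ∀ t ∈ Z, t ∈ seg)
    (hZ : Z.card = s.card) (U : ℝ[X]) (hU : U.natDegree ≤ s.card)
    (hU0 : ∀ t ∈ Z, (wronskian P U).eval t = 0) : wronskian P U = 0 := by
  refine eq_zero_of_infinite_isRoot _ (Set.Infinite.mono (s := seg) (fun x hx => ?_)
    (Set.Icc_infinite (by norm_num)))
  change (wronskian P U).eval x = 0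
  by_cases hxZ : x ∈ Z
  · exact hU0 x hxZ
  obtain ⟨a, ha, haU⟩ := exists_alternating_annihilator hP hreal hnd hpoles (insert x Z)
    (fun t ht => (Finset.mem_insert.1 ht).elim (fun h => h ▸ hx) (hZseg t))
    (by rw [Finset.card_insert_of_notMem hxZ, hZ])
  have h := haU U hU
  rw [Finset.sum_insert hxZ, Finset.sum_eq_zero fun t ht => by rw [hU0 t ht, mul_zero],
    add_zero] at h
  exact (mul_eq_zero.1 h).resolve_left (left_ne_zero_of_mul (ha x (by simp)).ne')

/-- At a zero z of P the Wronskian equals -P'(z)U(z), and P'(z) ≠ 0 because the zeros are simple. -/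
theorem eval_eq_zero_of_wronskian_eq_zero (hP : IsPolePoly s P) (hnd : s.Nodup) (U : ℝ[X])
    (hU : wronskian P U = 0) (z : ℂ) (hz : z ∈ s) : (U.map Complex.ofRealHom).eval z = 0 := by
  have h := congrArg (fun p => eval z (p.map Complex.ofRealHom)) hU
  simp only [map_wronskian] at h
  simp only [wronskian, eval_sub, eval_mul, (hP.eval_eq_zero_iff z).2 hz,
    zero_mul, zero_sub, Polynomial.map_zero, eval_zero, neg_eq_zero] at h
  refine (mul_eq_zero.1 h).resolve_left ?_
  have hz' : z ∈ s.toFinset := Multiset.mem_toFinset.2 hz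
  rw [hP.map_eq_nodal hnd]
  have := Lagrange.eval_nodal_derivative_eval_node_eq (v := (id : ℂ → ℂ)) hz'
  rw [id] at this
  rw [this, Lagrange.eval_nodal]
  exact Finset.prod_ne_zero_iff.2 fun u hu => sub_ne_zero.2 (Finset.ne_of_mem_erase hu).symm

theorem eq_zero_of_wronskian_eq_zero (hP : IsPolePoly s P) (hnd : s.Nodup) (U : ℝ[X])
    (hUdeg : U.degree < s.card) (hU : wronskian P U = 0) : U = 0 := by
  rw [← Polynomial.map_eq_zero Complex.ofRealHom]
  refine eq_zero_of_degree_lt_of_eval_finset_eq_zero s.toFinset ?_ fun z hz =>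
    eval_eq_zero_of_wronskian_eq_zero hP hnd U hU z (Multiset.mem_toFinset.1 hz)
  rwa [degree_map, Multiset.toFinset_card_of_nodup hnd]

end Annihilator

/-! ### Residuals and the uniform norm. -/

/-- The difference `f - ρ` on the segment, as a real function. -/
def residual (f : ℝ → ℝ) (P : ℝ[X]) (x : ℝ) : ℝ := f x - P.derivative.eval x / P.eval x

theorem continuousOn_residual {f : ℝ → ℝ} (hf : ContinuousOn f seg) {P : ℝ[X]}
    (hP : ∀ x ∈ seg, P.eval x ≠ 0) : ContinuousOn (residual f P) seg :=
  hf.sub (P.derivative.continuous.continuousOn.div P.continuous.continuousOn hP)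

theorem residual_sub_residual (f : ℝ → ℝ) {P Q : ℝ[X]} {x : ℝ} (hP : P.eval x ≠ 0)
    (hQ : Q.eval x ≠ 0) :
    residual f P x - residual f Q x = (wronskian P Q).eval x / (P.eval x * Q.eval x) := by
  simp only [residual, wronskian, eval_sub, eval_mul]
  field_simp
  ring

theorem zero_mem_seg : (0 : ℝ) ∈ seg := by constructor <;> norm_num

section SupNorm

variable {f : ℝ → ℝ} {s : Multiset ℂ} {P : ℝ[X]}

theorem norm_diff_eq (hP : IsPolePoly s P) {x : ℝ} (hx : P.eval x ≠ 0) :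
    ‖diff f s x‖ = |residual f P x| := by
  rw [hP.diff_eq f hx, Complex.norm_real, Real.norm_eq_abs]; rfl

theorem abs_residual_le_supNorm (hf : ContinuousOn f seg) (hP : IsPolePoly s P)
    (hP0 : ∀ x ∈ seg, P.eval x ≠ 0) {x : ℝ} (hx : x ∈ seg) :
    |residual f P x| ≤ supNorm (diff f s) := by
  obtain ⟨B, hB⟩ := isCompact_Icc.bddAbove_image (continuousOn_residual hf hP0).abs
  rw [← norm_diff_eq hP (hP0 x hx)]
  refine le_ciSup (f := fun x : seg => ‖diff f s x‖) ⟨B, ?_⟩ ⟨x, hx⟩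
  rintro _ ⟨y, rfl⟩
  change ‖diff f s y‖ ≤ B
  rw [norm_diff_eq hP (hP0 y y.2)]
  exact hB ⟨y, y.2, rfl⟩

theorem supNorm_lt (hf : ContinuousOn f seg) (hP : IsPolePoly s P)
    (hP0 : ∀ x ∈ seg, P.eval x ≠ 0) {M : ℝ} (hM : ∀ x ∈ seg, |residual f P x| < M) :
    supNorm (diff f s) < M := by
  obtain ⟨x, hx, hmax⟩ := isCompact_Icc.exists_isMaxOn ⟨0, zero_mem_seg⟩
    (continuousOn_residual hf hP0).abs
  have : Nonempty seg := ⟨⟨0, zero_mem_seg⟩⟩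
  refine lt_of_le_of_lt (ciSup_le fun y => ?_) (hM x hx)
  rw [norm_diff_eq hP (hP0 y y.2)]
  exact hmax y.2

theorem supNorm_nonneg (g : ℝ → ℂ) : 0 ≤ supNorm g := Real.iSup_nonneg fun _ => norm_nonneg _

end SupNorm

/-! ### Sufficiency of the alternance. -/

/-- The sign of the derivative of the nodal polynomial at its increasingly ordered nodes. -/
theorem alternating_prod_sub_pos {n : ℕ} {t : Fin (n + 1) → ℝ} (ht : StrictMono t)
    (k : Fin (n + 1)) :
    0 < (∏ u ∈ (Finset.univ.image t).erase (t k), (t k - u)) * ((-1) ^ n * (-1) ^ (k : ℕ)) := by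
  have h1 : (Finset.univ.image t).erase (t k) = (Finset.univ.erase k).image t :=
    (Finset.image_erase ht.injective _ _).symm
  have h2 : (Finset.univ : Finset (Fin (n + 1))).erase k = Finset.Iio k ∪ Finset.Ioi k := by
    ext j
    simp only [Finset.mem_erase, Finset.mem_univ, and_true, Finset.mem_union, Finset.mem_Iio,
      Finset.mem_Ioi]
    exact ne_iff_lt_or_gt
  have h3 : Disjoint (Finset.Iio k) (Finset.Ioi k) :=
    Finset.disjoint_left.2 fun j hj hj' =>
      lt_asymm (Finset.mem_Iio.1 hj) (Finset.mem_Ioi.1 hj')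
  rw [h1, Finset.prod_image ht.injective.injOn, h2, Finset.prod_union h3]
  have h4 : ∏ j ∈ Finset.Ioi k, (t k - t j) =
      (-1) ^ (n - k : ℕ) * ∏ j ∈ Finset.Ioi k, (t j - t k) := by
    have hc : (Finset.Ioi k).card = n - k := by rw [Fin.card_Ioi]; omega
    rw [← hc, ← Finset.prod_const, ← Finset.prod_mul_distrib]
    exact Finset.prod_congr rfl fun j _ => by ring
  have h5 : ((-1 : ℝ)) ^ (n - k : ℕ) * ((-1) ^ n * (-1) ^ (k : ℕ)) = 1 := by
    have hk : n - k + k = n := Nat.sub_add_cancel (Nat.le_of_lt_succ k.2)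
    have : ((-1 : ℝ)) ^ (n - k : ℕ) * (-1) ^ (k : ℕ) = (-1) ^ n := by rw [← pow_add, hk]
    rw [mul_left_comm, this, ← pow_add, ← two_mul]
    simp
  have h6 : 0 < ∏ j ∈ Finset.Iio k, (t k - t j) :=
    Finset.prod_pos fun j hj => sub_pos.2 (ht (Finset.mem_Iio.1 hj))
  have h7 : 0 < ∏ j ∈ Finset.Ioi k, (t j - t k) :=
    Finset.prod_pos fun j hj => sub_pos.2 (ht (Finset.mem_Ioi.1 hj))
  rw [h4]
  calc (0 : ℝ) < (∏ j ∈ Finset.Iio k, (t k - t j)) * ∏ j ∈ Finset.Ioi k, (t j - t k) :=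
        mul_pos h6 h7
    _ = _ := by
      linear_combination (-(∏ j ∈ Finset.Iio k, (t k - t j)) * ∏ j ∈ Finset.Ioi k, (t j - t k)) * h5

theorem pos_of_mul_pos_of_mul_pos {a D σ : ℝ} (h1 : 0 < a * D) (h2 : 0 < D * σ) : 0 < a * σ := by
  have h3 := mul_pos h1 h2
  have h4 : a * D * (D * σ) = D ^ 2 * (a * σ) := by ring
  rw [h4] at h3
  exact pos_of_mul_pos_right h3 (sq_nonneg D)

/-- A logarithmic derivative which is at least as good as one with an alternance of `n + 1`
points coincides with it. -/
theorem eq_of_hasAlternance {n : ℕ} {s : Multiset ℂ} (hcard : s.card = n) (hreal : RealValued s)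
    (hnd : s.Nodup) (hpoles : ∀ z ∈ s, 1 < ‖z‖) {f : ℝ → ℝ} (hf : ContinuousOn f seg)
    (halt : HasAlternance (n + 1) (diff f s)) {s' : Multiset ℂ} (hs' : s' ∈ degreeLE n)
    (hle : supNorm (diff f s') ≤ supNorm (diff f s)) : s' = s := by
  obtain ⟨hcard', hreal', hfin'⟩ := hs'
  obtain ⟨P, hP⟩ := exists_isPolePoly hreal
  obtain ⟨Q, hQ⟩ := exists_isPolePoly hreal'
  have hP0 := hP.finiteOnSeg_iff.1 (finiteOnSeg_of_one_lt_norm hpoles)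
  have hQ0 := hQ.finiteOnSeg_iff.1 hfin'
  obtain ⟨εP, hεP⟩ := exists_sign_of_ne_zero P hP0
  obtain ⟨εQ, hεQ⟩ := exists_sign_of_ne_zero Q hQ0
  obtain ⟨t, htmono, htseg, ε, hε, hval⟩ := halt
  set M := supNorm (diff f s) with hM
  have hM0 : 0 ≤ M := supNorm_nonneg _
  have hQdeg : Q.natDegree ≤ s.card := by rw [hQ.natDegree_eq, hcard]; exact hcard'
  set T : Finset ℝ := Finset.univ.image t with hT
  have hTcard : T.card = s.card + 1 := by
    rw [hT, Finset.card_image_of_injective _ htmono.injective, Finset.card_univ,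
      Fintype.card_fin, hcard]
  have hTseg : ∀ x ∈ T, x ∈ seg := fun x hx => by
    obtain ⟨k, -, rfl⟩ := Finset.mem_image.1 hx
    exact htseg k
  obtain ⟨a, ha, haU⟩ := exists_alternating_annihilator hP hreal hnd hpoles T hTseg hTcard
  have hsq : ∀ k : ℕ, ((-1 : ℝ) ^ k) * (-1) ^ k = 1 := fun k => by
    rw [← mul_pow]; simp
  have hεsq : ε * ε = 1 := by rcases hε with rfl | rfl <;> norm_num
  have hWsign : ∀ k : Fin (n + 1),
      0 ≤ ε * (-1) ^ (k : ℕ) * ((εP * εQ) * (wronskian P Q).eval (t k)) := by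
    intro k
    have h1 : residual f P (t k) = ε * (-1) ^ (k : ℕ) * M := by
      have := hval k
      rw [hP.diff_eq f (hP0 _ (htseg k))] at this
      exact_mod_cast this
    have h2 : |residual f Q (t k)| ≤ M :=
      (abs_residual_le_supNorm hf hQ hQ0 (htseg k)).trans hle
    have h3 := residual_sub_residual f (hP0 _ (htseg k)) (hQ0 _ (htseg k))
    set σ : ℝ := ε * (-1) ^ (k : ℕ) with hσ
    have hσ2 : σ * σ = 1 := by
      have : σ * σ = (ε * ε) * ((-1) ^ (k : ℕ) * (-1) ^ (k : ℕ)) := by rw [hσ]; ring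
      rw [this, hεsq, hsq, one_mul]
    -- The residual of P is σM here and that of Q is at most M in absolute value.
    have h4 : 0 ≤ σ * (residual f P (t k) - residual f Q (t k)) := by
      have h5 : |σ * residual f Q (t k)| ≤ M := by
        have : |σ| = 1 := by
          rcases mul_self_eq_one_iff.1 hσ2 with h | h <;> simp [h]
        rw [abs_mul, this, one_mul]; exact h2
      have h6 := (abs_le.1 h5).2
      rw [h1, mul_sub, ← mul_assoc, hσ2]
      linarith
    rw [h3] at h4
    have hp := hεP _ (htseg k)
    have hq := hεQ _ (htseg k)
    have h7 : σ * ((εP * εQ) * (wronskian P Q).eval (t k)) =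
        (εP * P.eval (t k)) * (εQ * Q.eval (t k)) *
          (σ * ((wronskian P Q).eval (t k) / (P.eval (t k) * Q.eval (t k)))) := by
      have := hP0 _ (htseg k)
      have := hQ0 _ (htseg k)
      field_simp
    rw [h7]
    exact mul_nonneg (mul_pos hp hq).le h4
  have hasign : ∀ k : Fin (n + 1), 0 < a (t k) * ((-1) ^ n * (-1) ^ (k : ℕ)) := fun k =>
    pos_of_mul_pos_of_mul_pos (ha (t k) (Finset.mem_image_of_mem t (Finset.mem_univ k)))
      (alternating_prod_sub_pos htmono k)
  set c : ℝ := (-1) ^ n * ε * (εP * εQ) with hc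
  have hc0 : c ≠ 0 := by
    have h1 := left_ne_zero_of_mul (hεP 0 zero_mem_seg).ne'
    have h2 := left_ne_zero_of_mul (hεQ 0 zero_mem_seg).ne'
    have h3 : ε ≠ 0 := left_ne_zero_of_mul (hεsq ▸ one_ne_zero)
    simp [hc, h1, h2, h3]
  -- The alternations of the annihilator and of the Wronskian cancel, so all terms of a vanishing
  -- sum have one sign.
  have hterm : ∀ x ∈ T, 0 ≤ c * (a x * (wronskian P Q).eval x) := fun x hx => by
    obtain ⟨k, -, rfl⟩ := Finset.mem_image.1 hx
    have h1 := mul_nonneg (hasign k).le (hWsign k)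
    have h2 : a (t k) * ((-1) ^ n * (-1) ^ (k : ℕ)) *
        (ε * (-1) ^ (k : ℕ) * ((εP * εQ) * (wronskian P Q).eval (t k))) =
        c * (a (t k) * (wronskian P Q).eval (t k)) := by
      linear_combination (c * (a (t k) * (wronskian P Q).eval (t k))) * hsq k
    rwa [h2] at h1
  have hsum : ∑ x ∈ T, c * (a x * (wronskian P Q).eval x) = 0 := by
    rw [← Finset.mul_sum, haU Q hQdeg, mul_zero]
  have hzero : ∀ x ∈ T, (wronskian P Q).eval x = 0 := fun x hx => by
    have h1 := (Finset.sum_eq_zero_iff_of_nonneg hterm).1 hsum x hx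
    have h2 := (mul_eq_zero.1 h1).resolve_left hc0
    exact (mul_eq_zero.1 h2).resolve_left (left_ne_zero_of_mul (ha x hx).ne')
  have hmem : t 0 ∈ T := Finset.mem_image_of_mem t (Finset.mem_univ 0)
  have hW : wronskian P Q = 0 :=
    wronskian_eq_zero_of_zeros hP hreal hnd hpoles (T.erase (t 0))
      (fun x hx => hTseg x (Finset.mem_of_mem_erase hx))
      (by rw [Finset.card_erase_of_mem hmem, hTcard]; rfl) Q hQdeg
      (fun x hx => hzero x (Finset.mem_of_mem_erase hx))
  -- As `s` has no repetitions, this is an inclusion of multisets; `s'` has at most n elements, so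
  -- equality follows.
  have hsub : s ⊆ s' := fun z hz =>
    (hQ.eval_eq_zero_iff z).1 (eval_eq_zero_of_wronskian_eq_zero hP hnd Q hW z hz)
  exact (Multiset.eq_of_le_of_card_le ((Multiset.le_iff_subset hnd).2 hsub) (by omega)).symm

/-! ### Necessity of the alternance. -/

/-- In a finite-dimensional space the convex hull of a compact set is compact. -/
theorem isCompact_convexHull_of_finiteDimensional {E : Type} [NormedAddCommGroup E]
    [NormedSpace ℝ E] [FiniteDimensional ℝ E] {K : Set E} (hK : IsCompact K) :
    IsCompact (convexHull ℝ K) := by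
  set d := Module.finrank ℝ E
  -- By Carathéodory, combinations of at most d + 1 points suffice, so the hull is a finite union of
  -- continuous images of compact sets.
  have hEq : convexHull ℝ K = ⋃ m ∈ Finset.range (d + 2),
      (fun p : (Fin m → ℝ) × (Fin m → E) => ∑ i, p.1 i • p.2 i) ''
        (stdSimplex ℝ (Fin m) ×ˢ Set.univ.pi fun _ => K) := by
    apply Set.Subset.antisymm
    · intro x hx
      obtain ⟨ι, _, z, w, hz, haff, hw, hw1, rfl⟩ := eq_pos_convex_span_of_mem_convexHull hx
      have hcard : Fintype.card ι ≤ d + 1 :=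
        haff.card_le_finrank_succ.trans (Nat.succ_le_succ (Submodule.finrank_le _))
      set e := Fintype.equivFin ι
      refine Set.mem_biUnion (x := Fintype.card ι)
        (Finset.mem_coe.2 (Finset.mem_range.2 (by omega)))
        ⟨(w ∘ e.symm, z ∘ e.symm), ⟨⟨fun i => (hw _).le, ?_⟩, fun i _ => hz ⟨_, rfl⟩⟩, ?_⟩
      · rw [← hw1]; exact e.symm.sum_comp w
      · exact e.symm.sum_comp fun i => w i • z i
    · refine Set.iUnion₂_subset fun m _ => ?_
      rintro _ ⟨⟨w, z⟩, ⟨⟨hw, hw1⟩, hz⟩, rfl⟩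
      exact (convex_convexHull ℝ K).sum_mem (fun i _ => hw i) hw1
        fun i _ => subset_convexHull ℝ K (hz i trivial)
  rw [hEq]
  refine (Finset.range (d + 2)).isCompact_biUnion fun m _ => ?_
  refine ((isCompact_stdSimplex ℝ (Fin m)).prod (isCompact_univ_pi fun _ => hK)).image ?_
  fun_prop

section Improve

variable {f : ℝ → ℝ} {s : Multiset ℂ} {P : ℝ[X]}

open Filter Topology in
/-- If some Wronskian `W(P, U)` has the sign of `f - ρ` at every extremal point, then `ρ` is not
a best approximant. -/
theorem exists_supNorm_lt (hP : IsPolePoly s P) (hP0 : ∀ x ∈ seg, P.eval x ≠ 0)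
    (hf : ContinuousOn f seg) (U : ℝ[X]) (hU : U.degree < s.card)
    (hsign : ∀ x ∈ seg, |residual f P x| = supNorm (diff f s) →
      0 < residual f P x * (wronskian P U).eval x) :
    ∃ s' ∈ degreeEQ s.card, supNorm (diff f s') < supNorm (diff f s) := by
  set M := supNorm (diff f s) with hM
  have hM0 : 0 ≤ M := supNorm_nonneg _
  set R : seg → ℝ := fun x => residual f P x with hR
  have hRcont : Continuous R := continuousOn_iff_continuous_domRestrict.1 (continuousOn_residual hf hP0)
  set G : ℝ × seg → ℝ := fun p => P.eval (p.2 : ℝ) * (P.eval (p.2 : ℝ) + p.1 * U.eval (p.2 : ℝ))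
    with hG
  have hGcont : Continuous G := by fun_prop
  set k : ℝ × seg → ℝ := fun p => (wronskian P U).eval (p.2 : ℝ) / G p with hk
  have hG0 : ∀ x : seg, G (0, x) ≠ 0 := fun x => by simp [hG, hP0 x x.2]
  have hkcont : ∀ x : seg, ContinuousAt k (0, x) := fun x => by
    refine ContinuousAt.div ?_ hGcont.continuousAt (hG0 x)
    exact Continuous.continuousAt (by fun_prop)
  have hRcont' : ∀ p : ℝ × seg, ContinuousAt (fun p : ℝ × seg => R p.2) p := fun p =>
    (hRcont.comp continuous_snd).continuousAt
  have hev : ∀ᶠ δ in 𝓝 (0 : ℝ), ∀ x ∈ (Set.univ : Set seg),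
      0 < δ → G (δ, x) ≠ 0 ∧ |R x - δ * k (δ, x)| < M := by
    have : CompactSpace seg := isCompact_iff_compactSpace.1 isCompact_Icc
    refine isCompact_univ.eventually_forall_of_forall_eventually
      (P := fun δ x => 0 < δ → G (δ, x) ≠ 0 ∧ |R x - δ * k (δ, x)| < M) fun x _ => ?_
    have h1 : ∀ᶠ p in 𝓝 ((0 : ℝ), x), G p ≠ 0 := hGcont.continuousAt.eventually_ne (hG0 x)
    have hRM : ∀ y, |R y| ≤ M := fun y => abs_residual_le_supNorm hf hP hP0 y.2
    rcases (hRM x).lt_or_eq with hlt | heq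
    · have hc : ContinuousAt (fun p : ℝ × seg => |R p.2 - p.1 * k p|) (0, x) :=
        ((hRcont' _).sub (continuousAt_fst.mul (hkcont x))).abs
      have h2 : ∀ᶠ p in 𝓝 ((0 : ℝ), x), |R p.2 - p.1 * k p| < M :=
        hc.eventually_lt continuousAt_const (by simpa using hlt)
      filter_upwards [h1, h2] with p hp1 hp2 _ using ⟨hp1, hp2⟩
    -- At an extremal point one uses (R - δk)² = R² - δ(2Rk - δk²), whose bracket is positive
    -- nearby.
    · have hc : ContinuousAt (fun p : ℝ × seg => 2 * (R p.2 * k p) - p.1 * k p ^ 2) (0, x) :=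
        (continuousAt_const.mul ((hRcont' _).mul (hkcont x))).sub
          (continuousAt_fst.mul ((hkcont x).pow 2))
      have hpos : 0 < R x * k (0, x) := by
        have h3 := hsign x x.2 heq
        have h4 : R x * k (0, x) =
            residual f P x * (wronskian P U).eval (x : ℝ) / (P.eval (x : ℝ)) ^ 2 := by
          simp only [hk, hG, hR, zero_mul, add_zero]
          ring
        have := hP0 x x.2
        rw [h4]
        positivity
      have h2 : ∀ᶠ p in 𝓝 ((0 : ℝ), x), 0 < 2 * (R p.2 * k p) - p.1 * k p ^ 2 :=
        continuousAt_const.eventually_lt hc (by simpa using hpos)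
      filter_upwards [h1, h2] with p hp1 hp2 hδ
      refine ⟨hp1, abs_lt_of_sq_lt_sq ?_ hM0⟩
      have h5 : R p.2 ^ 2 ≤ M ^ 2 := sq_le_sq' (abs_le.1 (hRM p.2)).1 (abs_le.1 (hRM p.2)).2
      change (R p.2 - p.1 * k p) ^ 2 < M ^ 2
      nlinarith [mul_pos hδ hp2]
  obtain ⟨δ, hδ, hδ0⟩ := ((hev.filter_mono nhdsWithin_le_nhds).and
    (self_mem_nhdsWithin : Set.Ioi (0 : ℝ) ∈ 𝓝[>] 0)).exists
  have hδ0' : 0 < δ := hδ0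
  set Q : ℝ[X] := P + C δ * U with hQdef
  have hPdeg : P.degree = s.card := by
    rw [degree_eq_natDegree hP.monic.ne_zero, hP.natDegree_eq]
  have hUdeg : (C δ * U).degree < P.degree := by
    rw [hPdeg, degree_C_mul hδ0'.ne']
    exact hU
  have hQmonic : Q.Monic := hP.monic.add_of_left hUdeg
  have hQeval : ∀ x, Q.eval x = P.eval x + δ * U.eval x := fun x => by simp [hQdef]
  have hQ0 : ∀ x ∈ seg, Q.eval x ≠ 0 := fun x hx => by
    rw [hQeval]
    exact right_ne_zero_of_mul (hδ ⟨x, hx⟩ trivial hδ0').1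
  have hQ := isPolePoly_roots hQmonic
  have hQdeg : (Q.map Complex.ofRealHom).roots.card = s.card := by
    rw [← hQ.natDegree_eq, ← hP.natDegree_eq, hQdef]
    exact natDegree_eq_of_degree_eq (degree_add_eq_left_of_degree_lt hUdeg)
  refine ⟨_, ⟨hQdeg, realValued_roots Q, hQ.finiteOnSeg_iff.2 hQ0⟩,
    supNorm_lt hf hQ hQ0 fun x hx => ?_⟩
  have h1 := residual_sub_residual f (hP0 x hx) (hQ0 x hx)
  have hW : wronskian P Q = δ • wronskian P U := by
    simp only [← wronskianBilin_apply, hQdef, map_add, ← smul_eq_C_mul, map_smul]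
    rw [wronskianBilin_apply, wronskian_self_eq_zero, zero_add]
  have h2 : residual f Q x = R ⟨x, hx⟩ - δ * k (δ, ⟨x, hx⟩) := by
    have h3 : residual f Q x = residual f P x - (wronskian P Q).eval x / (P.eval x * Q.eval x) := by
      linarith
    rw [h3, hW, hQeval, eval_smul, smul_eq_mul, mul_div_assoc]
  rw [h2]
  exact (hδ ⟨x, hx⟩ trivial hδ0').2

end Improve

section Necessity

variable {f : ℝ → ℝ} {s : Multiset ℂ} {P : ℝ[X]}

/-- Evaluations of Wronskians at `n` points of `[-1, 1]` are linearly independent. -/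
theorem eq_zero_of_sum_wronskian_eq_zero (hP : IsPolePoly s P) (hreal : RealValued s)
    (hnd : s.Nodup) (hpoles : ∀ z ∈ s, 1 < ‖z‖) (Z : Finset ℝ) (hZseg : ∀ t ∈ Z, t ∈ seg)
    (hZ : Z.card = s.card) (c : ℝ → ℝ)
    (hc : ∀ U : ℝ[X], U.degree < s.card → ∑ t ∈ Z, c t * (wronskian P U).eval t = 0)
    {x : ℝ} (hx : x ∈ Z) : c x = 0 := by
  set L : degreeLT ℝ s.card →ₗ[ℝ] (Z → ℝ) := LinearMap.pi fun t =>
    ((leval (t : ℝ)).comp (wronskianBilin ℝ P)).comp (Submodule.subtype _) with hL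
  have hLapply : ∀ U t, L U t = (wronskian P U).eval (t : ℝ) := fun U t => rfl
  have hinj : Function.Injective L := by
    rw [injective_iff_map_eq_zero]
    intro U hU
    have hdeg : (U : ℝ[X]).degree < s.card := mem_degreeLT.1 U.2
    have hW := wronskian_eq_zero_of_zeros hP hreal hnd hpoles Z hZseg hZ (U : ℝ[X])
      (natDegree_le_of_degree_le hdeg.le) fun t ht => by
        rw [← hLapply U ⟨t, ht⟩, hU]; rfl
    exact Subtype.ext (eq_zero_of_wronskian_eq_zero hP hnd _ hdeg hW)
  have hfin : Module.finrank ℝ (degreeLT ℝ s.card) = Module.finrank ℝ (Z → ℝ) := by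
    rw [(degreeLTEquiv ℝ s.card).finrank_eq]
    simp [hZ]
  have : FiniteDimensional ℝ (degreeLT ℝ s.card) :=
    Module.Finite.equiv (degreeLTEquiv ℝ s.card).symm
  -- Both spaces have dimension n, so injectivity yields a U whose Wronskian is 1 at x and 0 at the
  -- other nodes.
  obtain ⟨U, hU⟩ := (LinearMap.injective_iff_surjective_of_finrank_eq_finrank hfin).1 hinj
    (Pi.single ⟨x, hx⟩ 1)
  have h := hc U (mem_degreeLT.1 U.2)
  rw [Finset.sum_eq_single_of_mem x hx] at h
  · rw [← hLapply U ⟨x, hx⟩, hU, Pi.single_eq_same, mul_one] at h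
    exact h
  · intro t ht htx
    rw [← hLapply U ⟨t, ht⟩, hU, Pi.single_eq_of_ne (by simpa using htx), mul_zero]

/-- The Wronskians of `P` with the monomials of degree less than `n`. -/
def wronskianVec (P : ℝ[X]) (n : ℕ) (x : ℝ) : Fin n → ℝ :=
  fun i => (wronskian P (X ^ (i : ℕ))).eval x

theorem continuous_wronskianVec (P : ℝ[X]) (n : ℕ) : Continuous (wronskianVec P n) :=
  continuous_pi fun i => (wronskian P (X ^ (i : ℕ))).continuous

theorem eval_wronskian_eq_sum {n : ℕ} (P : ℝ[X]) {U : ℝ[X]} (hU : U.degree < n) (x : ℝ) :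
    (wronskian P U).eval x = ∑ i : Fin n, U.coeff i * wronskianVec P n x i := by
  have h : U = ∑ i : Fin n, U.coeff i • (X : ℝ[X]) ^ (i : ℕ) := by
    rw [Fin.sum_univ_eq_sum_range fun i => U.coeff i • (X : ℝ[X]) ^ i]
    by_cases h0 : U = 0
    · simp [h0]
    · rw [degree_eq_natDegree h0, Nat.cast_lt] at hU
      conv_lhs => rw [U.as_sum_range' n hU]
      simp [← smul_X_eq_monomial]
  conv_lhs => rw [h]
  rw [← wronskianBilin_apply, map_sum, eval_finsetSum]
  simp only [map_smul, eval_smul, smul_eq_mul, wronskianBilin_apply, wronskianVec]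

/-- For a best approximant, zero is a convex combination of the weighted evaluations at the
extremal points. -/
theorem zero_mem_convexHull (hP : IsPolePoly s P) (hP0 : ∀ x ∈ seg, P.eval x ≠ 0)
    (hf : ContinuousOn f seg)
    (hbest : ∀ s' ∈ degreeEQ s.card, supNorm (diff f s) ≤ supNorm (diff f s')) :
    (0 : Fin s.card → ℝ) ∈ convexHull ℝ ((fun x => residual f P x • wronskianVec P s.card x) ''
      {x | x ∈ seg ∧ |residual f P x| = supNorm (diff f s)}) := by
  set M := supNorm (diff f s) with hM
  set E : Set ℝ := {x | x ∈ seg ∧ |residual f P x| = M} with hE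
  set K := (fun x => residual f P x • wronskianVec P s.card x) '' E with hK
  have hr := continuousOn_residual hf hP0
  have hEcomp : IsCompact E := by
    have hcl : IsClosed (seg ∩ (fun x => |residual f P x|) ⁻¹' {M}) :=
      hr.abs.preimage_isClosed_of_isClosed isClosed_Icc isClosed_singleton
    exact isCompact_Icc.of_isClosed_subset hcl Set.inter_subset_left
  have hKcomp : IsCompact K := hEcomp.image_of_continuousOn
    ((hr.mono fun x hx => hx.1).smul (continuous_wronskianVec P _).continuousOn)
  by_contra h0
  obtain ⟨φ, u, hφ0, hφ⟩ := geometric_hahn_banach_point_closed (convex_convexHull ℝ K)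
    (isCompact_convexHull_of_finiteDimensional hKcomp).isClosed h0
  rw [map_zero] at hφ0
  -- The separating functional is evaluation of W(P,U) for the U with coefficients φ(e_i); its
  -- positivity on `K` contradicts optimality.
  set c : Fin s.card → ℝ := fun i => φ (Pi.single i 1) with hc
  set U : ℝ[X] := ∑ i : Fin s.card, c i • (X : ℝ[X]) ^ (i : ℕ) with hU
  have hUdeg : U.degree < s.card := by
    refine (degree_sum_le _ _).trans_lt ((Finset.sup_lt_iff (WithBot.bot_lt_coe _)).2 fun i _ => ?_)
    refine (degree_smul_le _ _).trans_lt ?_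
    rw [degree_X_pow]
    exact_mod_cast i.2
  have hφU : ∀ x, φ (wronskianVec P s.card x) = (wronskian P U).eval x := fun x => by
    conv_lhs => rw [← Finset.univ_sum_single (wronskianVec P s.card x)]
    rw [map_sum, ← wronskianBilin_apply, hU, map_sum, eval_finsetSum]
    refine Finset.sum_congr rfl fun i _ => ?_
    have : Pi.single i (wronskianVec P s.card x i) =
        wronskianVec P s.card x i • (Pi.single i 1 : Fin s.card → ℝ) := by
      rw [← Pi.single_smul, smul_eq_mul, mul_one]
    rw [this, map_smul, map_smul, eval_smul, smul_eq_mul, smul_eq_mul, mul_comm,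
      wronskianBilin_apply]
    rfl
  obtain ⟨s', hs', hlt⟩ := exists_supNorm_lt hP hP0 hf U hUdeg fun x hx hxM => by
    have h1 := hφ _ (subset_convexHull ℝ K ⟨x, ⟨hx, hxM⟩, rfl⟩)
    rw [map_smul, hφU, smul_eq_mul] at h1
    exact hφ0.trans h1
  exact (hbest s' hs').not_gt hlt

/-- A best approximant of exact degree `n` has an alternance of `n + 1` points. -/
theorem hasAlternance_of_best {n : ℕ} (hcard : s.card = n) (hreal : RealValued s)
    (hnd : s.Nodup) (hpoles : ∀ z ∈ s, 1 < ‖z‖) (hf : ContinuousOn f seg)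
    (hbest : ∀ s' ∈ degreeEQ n, supNorm (diff f s) ≤ supNorm (diff f s')) :
    HasAlternance (n + 1) (diff f s) := by
  subst hcard
  set n := s.card with hn
  obtain ⟨P, hP⟩ := exists_isPolePoly hreal
  have hP0 := hP.finiteOnSeg_iff.1 (finiteOnSeg_of_one_lt_norm hpoles)
  set M := supNorm (diff f s) with hM
  have hM0 : 0 ≤ M := supNorm_nonneg _
  have hseginf : seg.Infinite := Set.Icc_infinite (by norm_num)
  -- If M = 0 the residual vanishes on I and any n + 1 points serve.
  rcases hM0.eq_or_lt with hMz | hMpos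
  · obtain ⟨T, hTseg, hT⟩ := hseginf.exists_subset_card_eq (n + 1)
    refine ⟨T.orderEmbOfFin hT, (T.orderEmbOfFin hT).strictMono,
      fun k => hTseg (T.orderEmbOfFin_mem hT k), 1, Or.inl rfl, fun k => ?_⟩
    have hk := hTseg (T.orderEmbOfFin_mem hT k)
    have h := abs_residual_le_supNorm hf hP hP0 hk
    rw [← norm_diff_eq hP (hP0 _ hk), ← hM, ← hMz, norm_le_zero_iff] at h
    rw [h, ← hM, ← hMz, mul_zero, Complex.ofReal_zero]
  obtain ⟨ι, _, z, w, hz, haff, hw, hw1, hsum⟩ :=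
    eq_pos_convex_span_of_mem_convexHull (zero_mem_convexHull hP hP0 hf hbest)
  have hcardι : Fintype.card ι ≤ n + 1 := by
    refine haff.card_le_finrank_succ.trans (Nat.succ_le_succ ((Submodule.finrank_le _).trans ?_))
    simp [hn]
  choose x hx using fun i => hz ⟨i, rfl⟩
  have hxseg : ∀ i, x i ∈ seg := fun i => (hx i).1.1
  have hxM : ∀ i, |residual f P (x i)| = M := fun i => (hx i).1.2
  have hxz : ∀ i, residual f P (x i) • wronskianVec P n (x i) = z i := fun i => (hx i).2
  obtain ⟨T', hxT', hTseg', hTcard'⟩ := hseginf.exists_superset_ncard_eq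
    (s := Set.range x) (Set.range_subset_iff.2 hxseg) (Set.finite_range x) (k := n + 1) (by
      rw [← Set.image_univ, ← Finset.coe_univ, ← Finset.coe_image, Set.ncard_coe_finset]
      exact Finset.card_image_le.trans hcardι)
  have hTfin : T'.Finite := Set.finite_of_ncard_ne_zero (by omega)
  obtain ⟨T, rfl⟩ := hTfin.exists_finset_coe
  rw [Set.ncard_coe_finset] at hTcard'
  have hTseg : ∀ t ∈ T, t ∈ seg := fun t ht => hTseg' ht
  have hxT : ∀ i, x i ∈ T := fun i => hxT' ⟨i, rfl⟩
  -- The convex combination as weights on nodes; points added to reach n + 1 nodes carry weight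
  -- zero.
  set μ : ℝ → ℝ := fun t => ∑ i, if x i = t then w i * residual f P t else 0 with hμ
  have hμsum : ∀ U : ℝ[X], U.degree < n → ∑ t ∈ T, μ t * (wronskian P U).eval t = 0 := by
    intro U hU
    have h1 : ∑ t ∈ T, μ t * (wronskian P U).eval t =
        ∑ i, w i * residual f P (x i) * (wronskian P U).eval (x i) := by
      simp only [hμ, Finset.sum_mul, ite_mul, zero_mul]
      rw [Finset.sum_comm]
      refine Finset.sum_congr rfl fun i _ => ?_
      rw [Finset.sum_ite_eq T (x i), if_pos (hxT i)]
    rw [h1]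
    have h2 : ∀ i, w i * residual f P (x i) * (wronskian P U).eval (x i) =
        ∑ j : Fin n, U.coeff j * (w i • z i) j := fun i => by
      rw [eval_wronskian_eq_sum P hU, Finset.mul_sum, ← hxz i]
      refine Finset.sum_congr rfl fun j _ => ?_
      simp only [Pi.smul_apply, smul_eq_mul]
      ring
    simp only [h2]
    rw [Finset.sum_comm]
    refine Finset.sum_eq_zero fun j _ => ?_
    rw [← Finset.mul_sum, ← Finset.sum_apply, hsum, Pi.zero_apply, mul_zero]
  have hμr : ∀ t, 0 ≤ μ t * residual f P t := fun t => by
    rw [hμ, Finset.sum_mul]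
    refine Finset.sum_nonneg fun i _ => ?_
    split_ifs
    · rw [mul_assoc]
      exact mul_nonneg (hw i).le (mul_self_nonneg _)
    · simp
  obtain ⟨a, ha, haU⟩ := exists_alternating_annihilator hP hreal hnd hpoles T hTseg hTcard'
  have ha0 : ∀ t ∈ T, a t ≠ 0 := fun t ht => left_ne_zero_of_mul (ha t ht).ne'
  obtain ⟨t₀, ht₀⟩ : T.Nonempty := Finset.card_pos.1 (by omega)
  -- With this κ the functional μ - κa lives on the n nodes other than t₀, where evaluations are
  -- independent.
  set κ := μ t₀ / a t₀ with hκ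
  have hprop : ∀ t ∈ T, μ t = κ * a t := by
    intro t ht
    by_cases htt : t = t₀
    · rw [htt, hκ, div_mul_cancel₀ _ (ha0 t₀ ht₀)]
    have h1 := eq_zero_of_sum_wronskian_eq_zero hP hreal hnd hpoles (T.erase t₀)
      (fun u hu => hTseg u (Finset.mem_of_mem_erase hu))
      (by rw [Finset.card_erase_of_mem ht₀, hTcard']; rfl) (fun t => μ t - κ * a t)
      (fun U hU => by
        have h2 : (μ t₀ - κ * a t₀) * (wronskian P U).eval t₀ = 0 := by
          rw [hκ, div_mul_cancel₀ _ (ha0 t₀ ht₀), sub_self, zero_mul]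
        have h3 := Finset.add_sum_erase T (fun t => (μ t - κ * a t) * (wronskian P U).eval t) ht₀
        rw [h2, zero_add] at h3
        rw [h3]
        simp only [sub_mul, Finset.sum_sub_distrib, mul_assoc]
        rw [← Finset.mul_sum, hμsum U hU, haU U (natDegree_le_of_degree_le hU.le)]
        simp) (Finset.mem_erase.2 ⟨htt, ht⟩)
    exact sub_eq_zero.1 h1
  obtain ⟨i₀⟩ : Nonempty ι := by
    by_contra h
    rw [not_nonempty_iff] at h
    simp at hw1
  have hκ0 : κ ≠ 0 := by
    intro h
    have h1 := hprop (x i₀) (hxT i₀)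
    rw [h, zero_mul, hμ] at h1
    have h2 : 0 < (∑ i, if x i = x i₀ then w i * residual f P (x i₀) else 0) *
        residual f P (x i₀) := by
      rw [Finset.sum_mul]
      have hr0 : residual f P (x i₀) ≠ 0 := by
        rw [← abs_pos, hxM]; exact hMpos
      refine Finset.sum_pos' (fun i _ => ?_) ⟨i₀, Finset.mem_univ _, ?_⟩
      · split_ifs
        · rw [mul_assoc]
          exact mul_nonneg (hw i).le (mul_self_nonneg _)
        · simp
      · rw [if_pos rfl, mul_assoc]
        exact mul_pos (hw i₀) (mul_self_pos.2 hr0)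
    simp only at h1
    rw [h1, zero_mul] at h2
    exact lt_irrefl _ h2
  -- Since a has no zero on T, neither has μ: every node is some `x i`, so no point was really
  -- added.
  have hrM : ∀ t ∈ T, |residual f P t| = M := by
    intro t ht
    have h1 : μ t ≠ 0 := by rw [hprop t ht]; exact mul_ne_zero hκ0 (ha0 t ht)
    obtain ⟨i, -, hi⟩ := Finset.exists_ne_zero_of_sum_ne_zero h1
    have h2 : x i = t := by
      by_contra h; simp [h] at hi
    rw [← h2]; exact hxM i
  have hpos : ∀ t ∈ T, 0 < (κ * residual f P t) * a t := fun t ht => by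
    have h1 := hμr t
    rw [hprop t ht] at h1
    have h2 : residual f P t ≠ 0 := by rw [← abs_pos, hrM t ht]; exact hMpos
    have h3 := mul_ne_zero (mul_ne_zero hκ0 h2) (ha0 t ht)
    refine lt_of_le_of_ne ?_ h3.symm
    linarith
  set t := T.orderEmbOfFin hTcard' with ht
  have htT : ∀ k, t k ∈ T := T.orderEmbOfFin_mem hTcard'
  have hasign : ∀ k : Fin (n + 1), 0 < a (t k) * ((-1) ^ n * (-1) ^ (k : ℕ)) := fun k => by
    refine pos_of_mul_pos_of_mul_pos (ha (t k) (htT k)) ?_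
    have h := alternating_prod_sub_pos t.strictMono k
    rwa [Finset.image_orderEmbOfFin_univ] at h
  have hfinal : ∀ k : Fin (n + 1),
      0 < (κ * (-1) ^ n) * ((-1) ^ (k : ℕ) * residual f P (t k)) := fun k => by
    have h := pos_of_mul_pos_of_mul_pos (hpos (t k) (htT k)) (hasign k)
    convert h using 1
    ring
  have hval : ∀ k : Fin (n + 1), ∀ ε : ℝ, (ε = 1 ∨ ε = -1) →
      0 < ε * ((-1) ^ (k : ℕ) * residual f P (t k)) →
      diff f s (t k) = ((ε * (-1) ^ (k : ℕ) * M : ℝ) : ℂ) := fun k ε hε h => by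
    rw [hP.diff_eq f (hP0 _ (hTseg _ (htT k)))]
    congr 1
    change residual f P (t k) = _
    have h1 := hrM (t k) (htT k)
    rcases hε with rfl | rfl <;> rcases neg_one_pow_eq_or ℝ (k : ℕ) with h2 | h2 <;>
      rw [h2] at h ⊢ <;>
      first
      | (rw [abs_of_pos (by linarith)] at h1; linarith)
      | (rw [abs_of_neg (by linarith)] at h1; linarith)
  have hc0 : κ * (-1) ^ n ≠ 0 := mul_ne_zero hκ0 (pow_ne_zero _ (by norm_num))
  rcases hc0.lt_or_gt with hc | hc
  · exact ⟨t, t.strictMono, fun k => hTseg _ (htT k), -1, Or.inr rfl, fun k =>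
      hval k _ (Or.inr rfl) (by
        have := neg_of_mul_pos_right (hfinal k) hc.le
        linarith)⟩
  · exact ⟨t, t.strictMono, fun k => hTseg _ (htT k), 1, Or.inl rfl, fun k =>
      hval k _ (Or.inl rfl) (by
        have := pos_of_mul_pos_right (hfinal k) hc.le
        linarith)⟩

end Necessity

/-- The criterion for any class between the degrees `= n` and `≤ n`. -/
theorem isUniqueBest_iff_hasAlternance {n : ℕ} {s : Multiset ℂ} (hcard : s.card = n)
    (hreal : RealValued s) (hnd : s.Nodup) (hpoles : ∀ z ∈ s, 1 < ‖z‖) {f : ℝ → ℝ}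
    (hf : ContinuousOn f seg) {C : Set (Multiset ℂ)} (hCE : degreeEQ n ⊆ C)
    (hCL : C ⊆ degreeLE n) :
    IsUniqueBest C f s ↔ HasAlternance (n + 1) (diff f s) := by
  -- This direction needs only optimality against degree exactly n; the converse excludes every
  -- competitor of degree at most n, so one argument serves both classes.
  refine ⟨fun h => hasAlternance_of_best hcard hreal hnd hpoles hf fun s' hs' =>
    h.1.2 s' (hCE hs'), fun h => ?_⟩
  have hkey : ∀ s' ∈ C, supNorm (diff f s') ≤ supNorm (diff f s) → s' = s := fun s' hs' hle =>
    eq_of_hasAlternance hcard hreal hnd hpoles hf h (hCL hs') hle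
  have hsC : s ∈ C := hCE ⟨hcard, hreal, finiteOnSeg_of_one_lt_norm hpoles⟩
  refine ⟨⟨hsC, fun s' hs' => ?_⟩, fun s' hs' => hkey s' hs'.1 (hs'.2 s hsC)⟩
  by_contra! hlt
  rw [hkey s' hs' hlt.le] at hlt
  exact lt_irrefl _ hlt

end LogDer

end

theorem mainTheorem4 (n : ℕ) (s : Multiset ℂ) (hcard : s.card = n)
    (hreal : LogDer.RealValued s) (hdistinct : s.Nodup) (hpoles : ∀ z ∈ s, 1 < ‖z‖)
    (f : ℝ → ℝ) (hf : ContinuousOn f (Set.Icc (-1) 1)) :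
    (LogDer.IsUniqueBest (LogDer.degreeLE n) f s ↔
      LogDer.HasAlternance (n + 1) (LogDer.diff f s)) ∧
    (LogDer.IsUniqueBest (LogDer.degreeEQ n) f s ↔
      LogDer.HasAlternance (n + 1) (LogDer.diff f s)) :=
  have hsub : LogDer.degreeEQ n ⊆ LogDer.degreeLE n := fun _ h => ⟨h.1.le, h.2⟩
  ⟨LogDer.isUniqueBest_iff_hasAlternance hcard hreal hdistinct hpoles hf hsub subset_rfl,
    LogDer.isUniqueBest_iff_hasAlternance hcard hreal hdistinct hpoles hf subset_rfl hsub⟩
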